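/- For $\gamma,\xi\in\mathbb{R}$ let $\mathfrak{h}[\gamma,\xi]=-\frac{d^2}{dt^2}+(t-\xi)^2$ in $L^2(\mathbb{R}_+)$, $\mathbb{R}_+=(0,\infty)$, with domain $\{u\in B^2(\mathbb{R}_+) : u'(0)=\gamma u(0)\}$, where $B^2(\mathbb{R}_+)$ is the set of $u\in L^2(\mathbb{R}_+)$ with $t^p u^{(q)}\in L^2(\mathbb{R}_+)$ for all integers $p,q\ge 0$ with $p+q\le 2$ (distributional derivatives). Let $\mu_1(\gamma,\xi)\le\mu_2(\gamma,\xi)\le\dots$ be the eigenvalues of $\mathfrak{h}[\gamma,\xi]$ in increasing order, counted with multiplicity, and let $(x)_-=\max(-x,0)$. For $\gamma\in\mathbb{R}$ put $$\mathcal{J}(\gamma)=\sum_{j=1}^{\infty}\int_{\mathbb{R}}\big(\mu_j(\gamma,\xi)-1\big)_-\,d\xi .$$ Then: 1. The function $\mathcal{J}$ is well defined and finite (the integrands are measurable functions of $\xi$, and $\mathcal{J}(\gamma)<\infty$ for all $\gamma\in\mathbb{R}$), and $\mathcal{J}:\mathbb{R}\to\mathbb{R}$ is continuous: if $\gamma_h\to\gamma\in\mathbb{R}$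 as $h\to0$, then $\mathcal{J}(\gamma_h)\to\mathcal{J}(\gamma)$. 2. Only finitely many terms of the series are nonzero, locally uniformly in $\gamma$: for every $M>0$ there is $j_0\in\mathbb{N}$ such that $\int_{\mathbb{R}}(\mu_j(\gamma,\xi)-1)_-\,d\xi=0$ for all $\gamma\in(-M,M)$ and all $j>j_0$. -/

import Mathlib

open MeasureTheory Set
open scoped ENNReal ContDiff

/-- The Hilbert space `L²(ℝ₊)` of complex-valued functions, `ℝ₊ = (0, ∞)` with Lebesgue measure. -/
abbrev L2Half : Type := Lp ℂ 2 ((volume : Measure ℝ).restrict (Ioi 0))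

/-- `v ∈ L²(ℝ₊)` is the distributional derivative of order `q` of `u ∈ L²(ℝ₊)` on `(0, ∞)`. -/
def IsWeakDeriv (q : ℕ) (u v : L2Half) : Prop :=
  ∀ φ : ℝ → ℝ, ContDiff ℝ ∞ φ → HasCompactSupport φ → tsupport φ ⊆ Ioi 0 →
    ∫ t in Ioi (0 : ℝ), iteratedDeriv q φ t • u t
      = (-1) ^ q * ∫ t in Ioi (0 : ℝ), φ t • v t

/-- `u ∈ B^k(ℝ₊)`: `u ∈ L²(ℝ₊)` and `t^p u^(q) ∈ L²(ℝ₊)` for all `p + q ≤ k`, with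
distributional derivatives. (The case `p = 0` forces `u^(q) ∈ L²(ℝ₊)` for `q ≤ k`.) -/
def MemB (k : ℕ) (u : L2Half) : Prop :=
  ∀ q ≤ k, ∃ v : L2Half, IsWeakDeriv q u v ∧
    ∀ p, p + q ≤ k → MemLp (fun t : ℝ => t ^ p • v t) 2 (volume.restrict (Ioi 0))

/-- `a` is the boundary value `u(0)`: the value at `0` of the representative of `u` that is
continuous on `[0, ∞)`. -/
def HasTrace (u : L2Half) (a : ℂ) : Prop :=
  ∃ g : ℝ → ℂ, ContinuousOn g (Ici 0) ∧ (∀ᵐ t ∂(volume.restrict (Ioi (0 : ℝ))), u t = g t) ∧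
    g 0 = a

/-- The domain of `𝔥[γ, ξ]`: all `u ∈ B²(ℝ₊)` with `u'(0) = γ u(0)`. -/
def MemRobinDomain (γ : ℝ) (u : L2Half) : Prop :=
  MemB 2 u ∧ ∃ (u' : L2Half) (a : ℂ), IsWeakDeriv 1 u u' ∧ HasTrace u a ∧ HasTrace u' (γ * a)

/-- The graph of the operator `𝔥[γ, ξ] = -d²/dt² + (t - ξ)²` in `L²(ℝ₊)`: `u` lies in the domain
and `f = 𝔥[γ, ξ] u`. -/
def RobinGraph (γ ξ : ℝ) (u f : L2Half) : Prop :=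
  MemRobinDomain γ u ∧ ∃ u'' : L2Half, IsWeakDeriv 2 u u'' ∧
    ∀ᵐ t ∂(volume.restrict (Ioi (0 : ℝ))), f t = -u'' t + (t - ξ) ^ 2 • u t

/-- `u` is an eigenvector of `𝔥[γ, ξ]` with (real) eigenvalue `ν`. -/
def IsRobinEigenvector (γ ξ ν : ℝ) (u : L2Half) : Prop :=
  u ≠ 0 ∧ RobinGraph γ ξ u ((ν : ℂ) • u)

/-- `μ_j(γ, ξ)`, `j ≥ 1`: the `j`-th eigenvalue of `𝔥[γ, ξ]` in increasing order, counted with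
multiplicity, that is, the least `c` such that there are `j` linearly independent eigenvectors with
eigenvalues `≤ c`. It is read in `[-∞, ∞]`, where the infimum of the empty set is `∞`. -/
noncomputable def robinEigenvalue (j : ℕ) (γ ξ : ℝ) : EReal :=
  sInf {c : EReal | ∃ u : Fin j → L2Half, LinearIndependent ℂ u ∧
    ∀ i, ∃ ν : ℝ, (ν : EReal) ≤ c ∧ IsRobinEigenvector γ ξ ν (u i)}

/-- The negative part `(x)₋ = max(-x, 0)` as an element of `[0, ∞]`. -/
noncomputable def erealNegPart (x : EReal) : ℝ≥0∞ := (-x).toENNReal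

/-- The `j`-th term `∫_ℝ (μ_j(γ, ξ) - 1)₋ dξ ∈ [0, ∞]`. -/
noncomputable def robinTerm (j : ℕ) (γ : ℝ) : ℝ≥0∞ :=
  ∫⁻ ξ : ℝ, erealNegPart (robinEigenvalue j γ ξ - 1)

/-- `𝓙(γ) = ∑_{j ≥ 1} ∫_ℝ (μ_j(γ, ξ) - 1)₋ dξ ∈ [0, ∞]`. -/
noncomputable def robinJ (γ : ℝ) : ℝ≥0∞ := ∑' j : ℕ, robinTerm (j + 1) γ

/-!
Only eigenvalues below `1` contribute to `𝓙`, and for those the eigenfunctions are explicit. For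
`ν = 1 - 2b` with `b > 0`, the solution of `-v'' + (t - ξ)² v = ν v` that decays at `+∞` is
`v(t) = e^{-(t-ξ)²/2} M_b(ξ - t)` with `M_b(ξ) = ∫₀^∞ x^(b-1) e^{2ξx - x²} dx`, a parabolic cylinder
function. It is positive, and `v'(0) / v(0) = ξ - 2 R_b(ξ)`, where `R_b = M_{b+1} / M_b` is the mean
of `x` under the weight `x^(b-1) e^{2ξx - x²}`. So `v` satisfies the Robin condition if and only if
`2 R_b(ξ) = ξ - γ` (`isRobinEigenvector_cylSolLp`). Conversely, every eigenfunction with eigenvalue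
`1 - 2b` is a multiple of `v`, because the Wronskian of the two is constant and integrable on the
half-line (`IsRobinEigenvector.eq_smul_cylSolLp`).

By Chebyshev's inequality `b ↦ R_b(ξ)` is strictly increasing (`cylMean_strictMonoOn`), and it runs
from `0` to `∞`. Hence `𝔥[γ, ξ]` has an eigenvalue below `1` if and only if `γ < ξ`, and then exactly
one, which is simple. All terms of the series with `j ≥ 2` vanish, and
`(μ₁(γ, ξ) - 1)₋ = robinGap γ ξ`, the number `2b` with `2 R_b(ξ) = ξ - γ` if `γ < ξ` and `0`
otherwise.

For `a > 0` the inequality `robinGap γ ξ > a` means `2 R_{a/2}(ξ) < ξ - γ`, and likewise with both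
signs reversed. This shows that `robinGap` is jointly continuous and decreasing in `γ`, and an
estimate of `R_b` for small `b` gives `robinGap γ ξ ≤ e^{-ξ}` for large `ξ`. Since `robinGap γ ξ = 0`
for `ξ ≤ γ`, the integral over `ξ` is finite, and it depends continuously on `γ` by dominated
convergence.
-/

open Filter Topology

/-! ### Moments of the weight `x^(b-1) e^{2ξx - x²}` -/

/-- The weight `x^(b-1) e^{2ξx - x²}` on `(0, ∞)`. -/
noncomputable def cylKernel (b ξ x : ℝ) : ℝ := x ^ (b - 1) * Real.exp (2 * ξ * x - x ^ 2)

/-- The moment `M_b(ξ) = ∫₀^∞ x^(b-1) e^{2ξx - x²} dx`, finite for `b > 0`. Up to a Gaussian factor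
and a normalisation, `M_b(-ξ)` is the parabolic cylinder function `D_{-b}` at `√2 ξ`. -/
noncomputable def cylMoment (b ξ : ℝ) : ℝ := ∫ x in Ioi (0 : ℝ), cylKernel b ξ x

/-- The mean value `R_b(ξ) = M_{b+1}(ξ) / M_b(ξ)` of `x` under the weight `x^(b-1) e^{2ξx - x²}`. -/
noncomputable def cylMean (b ξ : ℝ) : ℝ := cylMoment (b + 1) ξ / cylMoment b ξ

lemma cylKernel_pos {b ξ x : ℝ} (hx : 0 < x) : 0 < cylKernel b ξ x := by
  unfold cylKernel; positivity

lemma mul_cylKernel {b ξ x : ℝ} (hx : 0 < x) : x * cylKernel b ξ x = cylKernel (b + 1) ξ x := by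
  unfold cylKernel
  rw [show b + 1 - 1 = (b - 1) + 1 by ring, Real.rpow_add_one hx.ne']
  ring

lemma rpow_mul_cylKernel {b c ξ x : ℝ} (hx : 0 < x) :
    x ^ c * cylKernel b ξ x = cylKernel (b + c) ξ x := by
  unfold cylKernel
  rw [show b + c - 1 = c + (b - 1) by ring, Real.rpow_add hx]
  ring

lemma measurable_cylKernel (b ξ : ℝ) : Measurable (cylKernel b ξ) := by
  unfold cylKernel; fun_prop

lemma integrableOn_cylKernel {b : ℝ} (hb : 0 < b) (ξ : ℝ) :
    IntegrableOn (cylKernel b ξ) (Ioi 0) := by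
  have h := (integrableOn_rpow_mul_exp_neg_mul_sq (b := 1 / 2) (by norm_num)
    (show -1 < b - 1 by linarith)).const_mul (Real.exp (2 * ξ ^ 2))
  refine Integrable.mono' h (measurable_cylKernel b ξ).aestronglyMeasurable ?_
  filter_upwards [ae_restrict_mem measurableSet_Ioi] with x hx
  rw [Real.norm_of_nonneg (cylKernel_pos hx).le, cylKernel, mul_left_comm, ← Real.exp_add]
  have hx0 : (0 : ℝ) < x := hx
  gcongr
  nlinarith [sq_nonneg (2 * ξ - x)]

/-- A function that is nonnegative on `(a, ∞)`, and positive there off a null set, has positive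
integral. -/
lemma setIntegral_Ioi_pos {f : ℝ → ℝ} {a : ℝ} (hf : IntegrableOn f (Ioi a))
    (h0 : ∀ x ∈ Ioi a, 0 ≤ f x) (s : Set ℝ) (hs : volume s = 0)
    (hpos : ∀ x ∈ Ioi a, x ∉ s → 0 < f x) : 0 < ∫ x in Ioi a, f x := by
  rw [setIntegral_pos_iff_support_of_nonneg_ae]
  · have hsub : Ioi a \ s ⊆ Function.support f ∩ Ioi a :=
      fun x hx => ⟨(hpos x hx.1 hx.2).ne', hx.1⟩
    refine lt_of_lt_of_le ?_ (measure_mono hsub)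
    rw [measure_sdiff_null hs, Real.volume_Ioi]
    exact ENNReal.zero_lt_top
  · exact (ae_restrict_mem measurableSet_Ioi).mono h0
  · exact hf

lemma cylMoment_pos {b : ℝ} (hb : 0 < b) (ξ : ℝ) : 0 < cylMoment b ξ :=
  setIntegral_Ioi_pos (integrableOn_cylKernel hb ξ) (fun _ hx => (cylKernel_pos hx).le) ∅
    measure_empty (fun _ hx _ => cylKernel_pos hx)

lemma cylMean_pos {b : ℝ} (hb : 0 < b) (ξ : ℝ) : 0 < cylMean b ξ :=
  div_pos (cylMoment_pos (by linarith) ξ) (cylMoment_pos hb ξ)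

lemma cylMoment_add_one {b : ℝ} (hb : 0 < b) (ξ : ℝ) :
    cylMoment (b + 1) ξ = cylMean b ξ * cylMoment b ξ := by
  rw [cylMean, div_mul_cancel₀ _ (cylMoment_pos hb ξ).ne']

lemma integrableOn_sub_mul_cylKernel {b : ℝ} (hb : 0 < b) (ξ c : ℝ) :
    IntegrableOn (fun x => (x - c) * cylKernel b ξ x) (Ioi 0) := by
  have h := (integrableOn_cylKernel (show 0 < b + 1 by linarith) ξ).sub
    ((integrableOn_cylKernel hb ξ).const_mul c)
  refine h.congr_fun (fun x hx => ?_) measurableSet_Ioi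
  simp only [Pi.sub_apply, ← mul_cylKernel hx]
  ring

lemma integral_sub_mul_cylKernel {b : ℝ} (hb : 0 < b) (ξ c : ℝ) :
    ∫ x in Ioi (0 : ℝ), (x - c) * cylKernel b ξ x = (cylMean b ξ - c) * cylMoment b ξ := by
  have h : ∫ x in Ioi (0 : ℝ), (x - c) * cylKernel b ξ x
      = ∫ x in Ioi (0 : ℝ), (cylKernel (b + 1) ξ x - c * cylKernel b ξ x) := by
    refine setIntegral_congr_fun measurableSet_Ioi fun x hx => ?_
    simp only [← mul_cylKernel hx]
    ring
  rw [h, integral_sub (integrableOn_cylKernel (by linarith) ξ)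
    ((integrableOn_cylKernel hb ξ).const_mul c), integral_const_mul]
  change cylMoment (b + 1) ξ - c * cylMoment b ξ = _
  rw [cylMoment_add_one hb]
  ring

lemma hasDerivAt_cylExponent (ξ x : ℝ) :
    HasDerivAt (fun y : ℝ => 2 * ξ * y - y ^ 2) (2 * ξ - 2 * x) x := by
  refine (((hasDerivAt_id x).const_mul (2 * ξ)).sub (hasDerivAt_pow 2 x)).congr_deriv ?_
  norm_num

/-- The three-term recurrence, from `∫₀^∞ (x^b e^{2ξx - x²})' dx = 0`. -/
lemma cylMoment_recurrence {b : ℝ} (hb : 0 < b) (ξ : ℝ) :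
    b * cylMoment b ξ + 2 * ξ * cylMoment (b + 1) ξ - 2 * cylMoment (b + 2) ξ = 0 := by
  have hd : ∀ x ∈ Ioi (0 : ℝ), HasDerivAt (cylKernel (b + 1) ξ)
      (b * cylKernel b ξ x + 2 * ξ * cylKernel (b + 1) ξ x - 2 * cylKernel (b + 2) ξ x) x := by
    intro x hx
    have h1 := Real.hasDerivAt_rpow_const (x := x) (p := b) (Or.inl (ne_of_gt hx))
    have h2 := hasDerivAt_cylExponent ξ x
    have h3 := h1.mul h2.exp
    have e : cylKernel (b + 1) ξ = fun y => y ^ b * Real.exp (2 * ξ * y - y ^ 2) := by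
      funext y; simp [cylKernel]
    rw [show b + 2 = b + 1 + 1 by ring, ← mul_cylKernel (b := b + 1) hx, e]
    refine h3.congr_deriv ?_
    simp only [cylKernel]
    ring
  have hint : IntegrableOn (fun x => b * cylKernel b ξ x + 2 * ξ * cylKernel (b + 1) ξ x
      - 2 * cylKernel (b + 2) ξ x) (Ioi 0) :=
    (((integrableOn_cylKernel hb ξ).const_mul b).add
      ((integrableOn_cylKernel (by linarith) ξ).const_mul (2 * ξ))).sub
      ((integrableOn_cylKernel (by linarith) ξ).const_mul 2)
  have hlim := tendsto_zero_of_hasDerivAt_of_integrableOn_Ioi hd hint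
    (integrableOn_cylKernel (by linarith) ξ)
  have hc : ContinuousWithinAt (cylKernel (b + 1) ξ) (Ici 0) 0 := by
    have : Continuous (cylKernel (b + 1) ξ) := by
      unfold cylKernel
      have : Continuous fun x : ℝ => x ^ (b + 1 - 1) :=
        Real.continuous_rpow_const (by linarith)
      fun_prop
    exact this.continuousWithinAt
  have h := integral_Ioi_of_hasDerivAt_of_tendsto hc hd hint hlim
  have h0 : cylKernel (b + 1) ξ 0 = 0 := by
    simp [cylKernel, Real.zero_rpow hb.ne']
  have i1 := integrableOn_cylKernel hb ξ
  have i2 := integrableOn_cylKernel (show 0 < b + 1 by linarith) ξ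
  have i3 := integrableOn_cylKernel (show 0 < b + 2 by linarith) ξ
  have i12 : IntegrableOn (fun x => b * cylKernel b ξ x + 2 * ξ * cylKernel (b + 1) ξ x) (Ioi 0) :=
    (i1.const_mul b).add (i2.const_mul (2 * ξ))
  rw [integral_sub i12 (i3.const_mul 2), integral_add (i1.const_mul b) (i2.const_mul (2 * ξ)),
    integral_const_mul, integral_const_mul,
    integral_const_mul, h0, sub_zero] at h
  exact h

/-- The moments are differentiable in `ξ`, with derivative given by the next moment. -/
lemma hasDerivAt_cylMoment {b : ℝ} (hb : 0 < b) (ξ : ℝ) :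
    HasDerivAt (cylMoment b) (2 * cylMoment (b + 1) ξ) ξ := by
  have h := (hasDerivAt_integral_of_dominated_loc_of_deriv_le (μ := volume.restrict (Ioi (0 : ℝ)))
    (F := fun η x => cylKernel b η x) (F' := fun η x => 2 * cylKernel (b + 1) η x) (x₀ := ξ)
    (s := Iio (ξ + 1)) (bound := fun x => 2 * cylKernel (b + 1) (ξ + 1) x)
    (Iio_mem_nhds (by linarith))
    (Eventually.of_forall fun η => (measurable_cylKernel b η).aestronglyMeasurable)
    (integrableOn_cylKernel hb ξ)
    ((measurable_cylKernel (b + 1) ξ).const_mul 2).aestronglyMeasurable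
    ?_ ((integrableOn_cylKernel (by linarith) _).const_mul 2) ?_).2
  · rw [integral_const_mul] at h
    exact h
  · filter_upwards [ae_restrict_mem measurableSet_Ioi] with x hx η hη
    have hx0 : (0 : ℝ) < x := hx
    have hη' : η < ξ + 1 := hη
    rw [Real.norm_of_nonneg (mul_nonneg zero_le_two (cylKernel_pos hx).le)]
    unfold cylKernel
    gcongr
  · filter_upwards [ae_restrict_mem measurableSet_Ioi] with x hx η hη
    have h2 : HasDerivAt (fun y : ℝ => 2 * y * x - x ^ 2) (2 * x) η := by
      have := (((hasDerivAt_id η).const_mul 2).mul_const x).sub_const (x ^ 2)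
      simpa using this
    have h3 := h2.exp.const_mul (x ^ (b - 1))
    rw [← mul_cylKernel hx]
    refine h3.congr_deriv ?_
    unfold cylKernel
    ring

lemma continuous_cylMoment {b : ℝ} (hb : 0 < b) : Continuous (cylMoment b) :=
  continuous_iff_continuousAt.2 fun ξ => (hasDerivAt_cylMoment hb ξ).continuousAt

lemma cylMoment_mono {b : ℝ} (hb : 0 < b) : Monotone (cylMoment b) := by
  intro ξ η h
  refine setIntegral_mono_on (integrableOn_cylKernel hb ξ) (integrableOn_cylKernel hb η)
    measurableSet_Ioi fun x hx => ?_
  have hx0 : (0 : ℝ) < x := hx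
  unfold cylKernel
  gcongr

lemma continuous_cylMean {b : ℝ} (hb : 0 < b) : Continuous (cylMean b) :=
  (continuous_cylMoment (by linarith)).div (continuous_cylMoment hb)
    fun ξ => (cylMoment_pos hb ξ).ne'

lemma continuousOn_cylMoment_left (ξ : ℝ) : ContinuousOn (fun b => cylMoment b ξ) (Ioi 0) := by
  -- Near `b` the weights are dominated by the sum of those for `b / 2` (on `x ≤ 1`) and `b + 1`
  -- (on `x ≥ 1`).
  intro b hb
  have hb : (0 : ℝ) < b := hb
  refine ContinuousAt.continuousWithinAt ?_
  refine continuousAt_of_dominated (μ := volume.restrict (Ioi (0 : ℝ)))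
    (F := fun b x => cylKernel b ξ x)
    (bound := fun x => cylKernel (b / 2) ξ x + cylKernel (b + 1) ξ x)
    (Eventually.of_forall fun c => (measurable_cylKernel c ξ).aestronglyMeasurable) ?_
    ((integrableOn_cylKernel (by linarith) ξ).add (integrableOn_cylKernel (by linarith) ξ)) ?_
  · filter_upwards [Ioo_mem_nhds (show b / 2 < b by linarith) (show b < b + 1 by linarith)]
      with c hc
    filter_upwards [ae_restrict_mem measurableSet_Ioi] with x hx
    have hx0 : (0 : ℝ) < x := hx
    rw [Real.norm_of_nonneg (cylKernel_pos hx).le]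
    unfold cylKernel
    rw [← add_mul]
    gcongr
    rcases le_total x 1 with h1 | h1
    · have := Real.rpow_le_rpow_of_exponent_ge hx0 h1 (show b / 2 - 1 ≤ c - 1 by linarith [hc.1])
      have := Real.rpow_nonneg hx0.le (b + 1 - 1)
      linarith
    · have := Real.rpow_le_rpow_of_exponent_le h1 (show c - 1 ≤ b + 1 - 1 by linarith [hc.2])
      have := Real.rpow_nonneg hx0.le (b / 2 - 1)
      linarith
  · filter_upwards [ae_restrict_mem measurableSet_Ioi] with x hx
    have hx0 : (0 : ℝ) < x := hx
    unfold cylKernel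
    have : ContinuousAt (fun c : ℝ => x ^ (c - 1)) b :=
      (Real.continuousAt_const_rpow hx0.ne').comp (by fun_prop)
    exact this.mul continuousAt_const

lemma continuousOn_cylMean_left (ξ : ℝ) : ContinuousOn (fun b => cylMean b ξ) (Ioi 0) := by
  refine ContinuousOn.div ?_ (continuousOn_cylMoment_left ξ) fun b hb => (cylMoment_pos hb ξ).ne'
  exact (continuousOn_cylMoment_left ξ).comp (f := fun b : ℝ => b + 1) (by fun_prop)
    fun b hb => show (0 : ℝ) < b + 1 by linarith [show (0 : ℝ) < b from hb]

/-- Chebyshev's inequality: the mean of `x` grows when the weight is multiplied by an increasing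
power of `x`. With `c` the mean for `b`, the integral of `(x - c) (x^(b'-b) - c^(b'-b))` against
the weight for `b` is positive. -/
lemma cylMean_strictMonoOn (ξ : ℝ) : StrictMonoOn (fun b => cylMean b ξ) (Ioi 0) := by
  intro b hb b' hb' hlt
  have hb : (0 : ℝ) < b := hb
  have hb' : (0 : ℝ) < b' := hb'
  set c := cylMean b ξ with hc
  have hc0 : 0 < c := cylMean_pos hb ξ
  have hd : 0 < b' - b := by linarith
  have e : ∀ x ∈ Ioi (0 : ℝ),
      (x - c) * cylKernel b' ξ x - c ^ (b' - b) * ((x - c) * cylKernel b ξ x)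
      = (x - c) * (x ^ (b' - b) - c ^ (b' - b)) * cylKernel b ξ x := by
    intro x hx
    have := rpow_mul_cylKernel (b := b) (c := b' - b) (ξ := ξ) hx
    rw [show b + (b' - b) = b' by ring] at this
    rw [← this]; ring
  have hint : IntegrableOn (fun x => (x - c) * cylKernel b' ξ x
      - c ^ (b' - b) * ((x - c) * cylKernel b ξ x)) (Ioi 0) :=
    (integrableOn_sub_mul_cylKernel hb' ξ c).sub
      ((integrableOn_sub_mul_cylKernel hb ξ c).const_mul _)
  have key : ∀ x ∈ Ioi (0 : ℝ), x ∉ ({c} : Set ℝ) → 0 < (x - c) * cylKernel b' ξ x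
      - c ^ (b' - b) * ((x - c) * cylKernel b ξ x) := by
    intro x hx hxc
    have hx0 : (0 : ℝ) < x := hx
    rw [e x hx]
    refine mul_pos ?_ (cylKernel_pos hx)
    rcases lt_or_gt_of_ne (show x ≠ c from hxc) with h | h
    · exact mul_pos_of_neg_of_neg (by linarith)
        (by linarith [Real.rpow_lt_rpow hx0.le h hd])
    · exact mul_pos (by linarith) (by linarith [Real.rpow_lt_rpow hc0.le h hd])
  have hpos := setIntegral_Ioi_pos hint (fun x hx => ?_) {c} (measure_singleton c) key
  · rw [integral_sub (integrableOn_sub_mul_cylKernel hb' ξ c)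
      ((integrableOn_sub_mul_cylKernel hb ξ c).const_mul _), integral_const_mul,
      integral_sub_mul_cylKernel hb', integral_sub_mul_cylKernel hb, ← hc, sub_self, zero_mul,
      mul_zero, sub_zero] at hpos
    have := (pos_iff_pos_of_mul_pos hpos).2 (cylMoment_pos hb' ξ)
    show c < cylMean b' ξ
    linarith
  · by_cases hxc : x = c
    · simp [hxc]
    · exact (key x hx hxc).le

lemma cylMean_recurrence {b : ℝ} (hb : 0 < b) (ξ : ℝ) :
    b = 2 * cylMean b ξ * (cylMean (b + 1) ξ - ξ) := by
  have h := cylMoment_recurrence hb ξ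
  have h1 := cylMoment_add_one hb ξ
  have h2 := cylMoment_add_one (show 0 < b + 1 by linarith) ξ
  rw [show b + 1 + 1 = b + 2 by ring, h1] at h2
  rw [h1, h2] at h
  have h3 : (b - 2 * cylMean b ξ * (cylMean (b + 1) ξ - ξ)) * cylMoment b ξ = 0 := by
    linear_combination h
  rcases mul_eq_zero.1 h3 with h | h
  · linarith
  · exact absurd h (cylMoment_pos hb ξ).ne'

/-- If `R_b` stayed below `c` the recurrence would bound `b = 2 R_b (R_{b+1} - ξ)`. -/
lemma exists_lt_cylMean (ξ c : ℝ) : ∃ b, 0 < b ∧ c < cylMean b ξ := by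
  by_contra! h
  have hc : 0 < c := lt_of_lt_of_le (cylMean_pos one_pos ξ) (h 1 one_pos)
  have hb : (0 : ℝ) < 2 * c * (c + |ξ|) + 1 := by positivity
  have h1 := cylMean_recurrence hb ξ
  have h2 := h _ hb
  have h3 := h _ (show 0 < (2 * c * (c + |ξ|) + 1) + 1 by linarith)
  have h4 := cylMean_pos hb ξ
  have : 2 * cylMean (2 * c * (c + |ξ|) + 1) ξ * (cylMean (2 * c * (c + |ξ|) + 1 + 1) ξ - ξ)
      ≤ 2 * c * (c + |ξ|) := by
    have : cylMean (2 * c * (c + |ξ|) + 1 + 1) ξ - ξ ≤ c + |ξ| := by linarith [neg_abs_le ξ]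
    calc _ ≤ 2 * cylMean (2 * c * (c + |ξ|) + 1) ξ * (c + |ξ|) := by gcongr
      _ ≤ _ := by gcongr
  linarith

/-- The identity `∫₀^∞ (e^{2ξx - x²})' dx = -1` gives `R_1 = ξ + 1 / (2 M_1)`. -/
lemma lt_cylMean_one (ξ : ℝ) : ξ < cylMean 1 ξ := by
  have hd : ∀ x ∈ Ioi (0 : ℝ), HasDerivAt (fun y : ℝ => -Real.exp (2 * ξ * y - y ^ 2))
      (2 * ((x - ξ) * cylKernel 1 ξ x)) x := by
    intro x _
    have h2 := hasDerivAt_cylExponent ξ x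
    refine h2.exp.neg.congr_deriv ?_
    simp [cylKernel]
    ring
  have hint := (integrableOn_sub_mul_cylKernel one_pos ξ ξ).const_mul 2
  have hi : IntegrableOn (fun y : ℝ => -Real.exp (2 * ξ * y - y ^ 2)) (Ioi 0) := by
    have := (integrableOn_cylKernel one_pos ξ).neg
    refine this.congr_fun (fun x _ => ?_) measurableSet_Ioi
    simp [cylKernel]
  have hlim := tendsto_zero_of_hasDerivAt_of_integrableOn_Ioi hd hint hi
  have h := integral_Ioi_of_hasDerivAt_of_tendsto (by fun_prop) hd hint hlim
  rw [integral_const_mul, integral_sub_mul_cylKernel one_pos] at h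
  simp only [mul_zero, ne_eq, OfNat.ofNat_ne_zero, not_false_eq_true, zero_pow, sub_zero,
    Real.exp_zero, sub_neg_eq_add, zero_add] at h
  have := (pos_iff_pos_of_mul_pos (show 0 < (cylMean 1 ξ - ξ) * cylMoment 1 ξ by linarith)).2
    (cylMoment_pos one_pos ξ)
  linarith

/-- By the recurrence and monotonicity, `R_b = b / (2 (R_{b+1} - ξ)) ≤ b / (2 (R_1 - ξ))`, which
tends to `0` with `b`. -/
lemma exists_cylMean_lt (ξ : ℝ) {c : ℝ} (hc : 0 < c) : ∃ b, 0 < b ∧ cylMean b ξ < c := by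
  have h1 := lt_cylMean_one ξ
  set d := cylMean 1 ξ - ξ with hd
  have hd0 : 0 < d := by linarith
  refine ⟨c * d, by positivity, ?_⟩
  have hb : 0 < c * d := by positivity
  have h2 := cylMean_recurrence hb ξ
  have h3 : cylMean 1 ξ < cylMean (c * d + 1) ξ :=
    cylMean_strictMonoOn ξ (show (0 : ℝ) < 1 from one_pos) (show (0 : ℝ) < c * d + 1 by linarith)
      (by linarith)
  have h4 := cylMean_pos hb ξ
  have h5 : cylMean (c * d) ξ * d < cylMean (c * d) ξ * (cylMean (c * d + 1) ξ - ξ) := by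
    gcongr; linarith
  by_contra! h6
  have h7 : c * d ≤ cylMean (c * d) ξ * d := by gcongr
  nlinarith

/-! ### The distance of the first eigenvalue from one -/

lemma exists_two_mul_cylMean_eq_iff {γ ξ : ℝ} :
    (∃ b, 0 < b ∧ 2 * cylMean b ξ = ξ - γ) ↔ γ < ξ := by
  constructor
  · rintro ⟨b, hb, h⟩
    linarith [cylMean_pos hb ξ]
  · intro h
    obtain ⟨b₁, hb₁, h₁⟩ := exists_cylMean_lt ξ (show 0 < (ξ - γ) / 2 by linarith)
    obtain ⟨b₂, hb₂, h₂⟩ := exists_lt_cylMean ξ ((ξ - γ) / 2)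
    obtain ⟨b, hb, hbe⟩ := isPreconnected_Ioi.intermediate_value (show b₁ ∈ Ioi 0 from hb₁)
      (show b₂ ∈ Ioi 0 from hb₂) (continuousOn_cylMean_left ξ) ⟨h₁.le, h₂.le⟩
    exact ⟨b, hb, by simp only at hbe; linarith⟩

open Classical in
/-- The distance `2b = 1 - μ₁(γ, ξ)` of the first eigenvalue from `1` if that eigenvalue is below
`1`, that is, the solution of `2 R_b(ξ) = ξ - γ`; it is `0` if there is no solution `b > 0`. -/
noncomputable def robinGap (γ ξ : ℝ) : ℝ :=
  if h : ∃ b, 0 < b ∧ 2 * cylMean b ξ = ξ - γ then 2 * h.choose else 0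

lemma robinGap_of_le {γ ξ : ℝ} (h : ξ ≤ γ) : robinGap γ ξ = 0 :=
  dif_neg fun h' => absurd (exists_two_mul_cylMean_eq_iff.1 h') h.not_gt

lemma robinGap_spec {γ ξ : ℝ} (h : γ < ξ) :
    0 < robinGap γ ξ ∧ 2 * cylMean (robinGap γ ξ / 2) ξ = ξ - γ := by
  have h' := exists_two_mul_cylMean_eq_iff.2 h
  rw [robinGap, dif_pos h', mul_div_cancel_left₀ _ two_ne_zero]
  exact ⟨mul_pos two_pos h'.choose_spec.1, h'.choose_spec.2⟩

lemma robinGap_nonneg (γ ξ : ℝ) : 0 ≤ robinGap γ ξ := by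
  rcases le_or_gt ξ γ with h | h
  · rw [robinGap_of_le h]
  · exact (robinGap_spec h).1.le

lemma lt_robinGap_iff {γ ξ a : ℝ} (ha : 0 < a) :
    a < robinGap γ ξ ↔ 2 * cylMean (a / 2) ξ < ξ - γ := by
  rcases le_or_gt ξ γ with h | h
  · rw [robinGap_of_le h]
    have := cylMean_pos (half_pos ha) ξ
    constructor <;> intro h' <;> linarith
  · obtain ⟨h0, h1⟩ := robinGap_spec h
    rw [← h1, mul_lt_mul_iff_right₀ two_pos, (cylMean_strictMonoOn ξ).lt_iff_lt
      (show a / 2 ∈ Ioi 0 from half_pos ha) (show robinGap γ ξ / 2 ∈ Ioi 0 from half_pos h0)]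
    constructor <;> intro h' <;> linarith

lemma robinGap_lt_iff {γ ξ a : ℝ} (ha : 0 < a) :
    robinGap γ ξ < a ↔ ξ - γ < 2 * cylMean (a / 2) ξ := by
  rcases le_or_gt ξ γ with h | h
  · rw [robinGap_of_le h]
    have := cylMean_pos (half_pos ha) ξ
    constructor <;> intro h' <;> linarith
  · obtain ⟨h0, h1⟩ := robinGap_spec h
    rw [← h1, mul_lt_mul_iff_right₀ two_pos, (cylMean_strictMonoOn ξ).lt_iff_lt
      (show robinGap γ ξ / 2 ∈ Ioi 0 from half_pos h0) (show a / 2 ∈ Ioi 0 from half_pos ha)]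
    constructor <;> intro h' <;> linarith

lemma robinGap_eq {γ ξ b : ℝ} (hb : 0 < b) (h : 2 * cylMean b ξ = ξ - γ) :
    robinGap γ ξ = 2 * b := by
  have h1 : (2 * b) / 2 = b := by ring
  refine le_antisymm (le_of_not_gt fun hlt => ?_) (le_of_not_gt fun hlt => ?_)
  · rw [lt_robinGap_iff (by positivity), h1] at hlt
    linarith
  · rw [robinGap_lt_iff (by positivity), h1] at hlt
    linarith

lemma robinGap_antitone (ξ : ℝ) : Antitone fun γ => robinGap γ ξ := by
  intro γ γ' h
  refine le_of_forall_lt fun a ha => ?_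
  rcases le_or_gt a 0 with h0 | h0
  · rcases h0.lt_or_eq with h0 | rfl
    · exact h0.trans_le (robinGap_nonneg _ _)
    · refine (robinGap_spec (lt_of_le_of_lt h (lt_of_not_ge fun h' => ?_))).1
      exact absurd ha (robinGap_of_le h').not_gt
  · rw [lt_robinGap_iff h0] at ha ⊢
    linarith

/-- Joint continuity needs only continuity of each `R_b` in `ξ`, because for `a > 0` the sets
`{robinGap > a}` and `{robinGap < a}` are given by strict inequalities between `2 R_{a/2}(ξ)` and
`ξ - γ`. -/
lemma continuous_robinGap : Continuous fun p : ℝ × ℝ => robinGap p.1 p.2 := by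
  refine OrderTopology.continuous_iff.2 fun a => ⟨?_, ?_⟩
  · rcases lt_trichotomy a 0 with h0 | rfl | h0
    · convert! isOpen_univ
      exact eq_univ_of_forall fun p => h0.trans_le (robinGap_nonneg _ _)
    · convert! isOpen_lt (continuous_fst (X := ℝ) (Y := ℝ)) continuous_snd
      ext p
      refine ⟨fun hp => lt_of_not_ge (α := ℝ) fun h' => ?_, fun hp => (robinGap_spec hp).1⟩
      exact absurd (show 0 < robinGap p.1 p.2 from hp) (robinGap_of_le h').not_gt
    · have hc := (continuous_cylMean (half_pos h0)).comp (continuous_snd (X := ℝ) (Y := ℝ))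
      convert! isOpen_lt (hc.const_mul 2) (continuous_snd.sub continuous_fst)
      ext p
      exact lt_robinGap_iff h0
  · rcases le_or_gt a 0 with h0 | h0
    · convert! isOpen_empty
      exact eq_empty_of_forall_notMem fun p hp =>
        absurd (robinGap_nonneg p.1 p.2) (not_le.2 (lt_of_lt_of_le hp h0))
    · have hc := (continuous_cylMean (half_pos h0)).comp (continuous_snd (X := ℝ) (Y := ℝ))
      convert! isOpen_lt (continuous_snd.sub continuous_fst) (hc.const_mul 2)
      ext p
      exact robinGap_lt_iff h0

/-- The weight on `(0, c]` is at most `x^(b-1) e^{2ξc - c²}`, while around `x = ξ` it is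
at least `e^{ξ² - 1} / (ξ + 1)`; the mean exceeds `c` as soon as the second part wins. -/
lemma le_cylMean_of_le {b c ξ : ℝ} (hb : 0 < b) (hc : 0 < c) (hcξ : c ≤ ξ)
    (hξ : 1 ≤ ξ)
    (h : c * Real.exp (2 * ξ * c - c ^ 2) * (c ^ b / b)
      ≤ (ξ - c) / (ξ + 1) * Real.exp (ξ ^ 2 - 1)) :
    c ≤ cylMean b ξ := by
  have hint := integrableOn_sub_mul_cylKernel hb ξ c
  have hrp : IntegrableOn (fun x : ℝ => x ^ (b - 1)) (Ioc 0 c) := by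
    rw [← intervalIntegrable_iff_integrableOn_Ioc_of_le hc.le]
    exact intervalIntegral.intervalIntegrable_rpow' (by linarith)
  have hsplit : ∫ x in Ioi (0 : ℝ), (x - c) * cylKernel b ξ x
      = (∫ x in Ioc 0 c, (x - c) * cylKernel b ξ x) + ∫ x in Ioi c, (x - c) * cylKernel b ξ x := by
    rw [← setIntegral_union (Ioc_disjoint_Ioi le_rfl) measurableSet_Ioi
      (hint.mono_set Ioc_subset_Ioi_self) (hint.mono_set (Ioi_subset_Ioi hc.le)),
      Ioc_union_Ioi_eq_Ioi hc.le]
  have hleft : -(c * Real.exp (2 * ξ * c - c ^ 2) * (c ^ b / b))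
      ≤ ∫ x in Ioc 0 c, (x - c) * cylKernel b ξ x := by
    have e : ∫ x in Ioc 0 c, x ^ (b - 1) = c ^ b / b := by
      rw [← intervalIntegral.integral_of_le hc.le, integral_rpow (Or.inl (by linarith))]
      rw [sub_add_cancel, Real.zero_rpow hb.ne', sub_zero]
    rw [← e, ← neg_mul, ← integral_const_mul]
    refine setIntegral_mono_on (hrp.const_mul _) (hint.mono_set Ioc_subset_Ioi_self)
      measurableSet_Ioc fun x hx => ?_
    have hx0 : 0 < x := hx.1
    have h1 : Real.exp (2 * ξ * x - x ^ 2) ≤ Real.exp (2 * ξ * c - c ^ 2) := by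
      refine Real.exp_le_exp.2 ?_
      nlinarith [hx.2]
    have h2 : (c - x) * (x ^ (b - 1) * Real.exp (2 * ξ * x - x ^ 2))
        ≤ c * (x ^ (b - 1) * Real.exp (2 * ξ * c - c ^ 2)) := by
      gcongr
      linarith
    rw [cylKernel]
    linarith
  have hright : (ξ - c) / (ξ + 1) * Real.exp (ξ ^ 2 - 1)
      ≤ ∫ x in Ioi c, (x - c) * cylKernel b ξ x := by
    have hsub : Ioc ξ (ξ + 1) ⊆ Ioi c := fun x hx => lt_of_le_of_lt hcξ hx.1
    have hi := hint.mono_set (Ioi_subset_Ioi hc.le)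
    have h1 : ∫ x in Ioc ξ (ξ + 1), (x - c) * cylKernel b ξ x
        ≤ ∫ x in Ioi c, (x - c) * cylKernel b ξ x := by
      refine setIntegral_mono_set hi ?_ hsub.eventuallyLE
      filter_upwards [ae_restrict_mem measurableSet_Ioi] with x hx
      exact mul_nonneg (sub_nonneg.2 (le_of_lt hx)) (cylKernel_pos (hc.trans hx)).le
    refine le_trans ?_ h1
    have e : (ξ - c) / (ξ + 1) * Real.exp (ξ ^ 2 - 1)
        = ∫ _ in Ioc ξ (ξ + 1), (ξ - c) / (ξ + 1) * Real.exp (ξ ^ 2 - 1) := by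
      simp
    rw [e]
    refine setIntegral_mono_on (integrableOn_const (by simp)) (hi.mono_set hsub)
      measurableSet_Ioc fun x hx => ?_
    have hx0 : 0 < x := by linarith [hx.1]
    have h3 : (ξ + 1)⁻¹ ≤ x ^ (b - 1) := by
      calc (ξ + 1)⁻¹ ≤ x⁻¹ := inv_anti₀ hx0 hx.2
        _ = x ^ (-1 : ℝ) := (Real.rpow_neg_one x).symm
        _ ≤ x ^ (b - 1) := Real.rpow_le_rpow_of_exponent_le (by linarith [hx.1]) (by linarith)
    have h4 : Real.exp (ξ ^ 2 - 1) ≤ Real.exp (2 * ξ * x - x ^ 2) := by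
      refine Real.exp_le_exp.2 ?_
      nlinarith [hx.1, hx.2]
    rw [cylKernel, div_eq_mul_inv, mul_assoc]
    have : ξ - c ≤ x - c := by linarith [hx.1]
    have : 0 ≤ x - c := by linarith
    gcongr
  rw [integral_sub_mul_cylKernel hb] at hsplit
  have h0 : 0 ≤ (cylMean b ξ - c) * cylMoment b ξ := by linarith
  linarith [nonneg_of_mul_nonneg_left h0 (cylMoment_pos hb ξ)]

/-- The first eigenvalue tends to `1` exponentially fast as `ξ → ∞`: for `b = e^{-ξ} / 2` the mean
`R_b(ξ)` already exceeds `(ξ - γ) / 2`. -/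
lemma robinGap_le_exp_neg {γ ξ : ℝ} (hξ : 40 ≤ ξ) (hγ : 2 * |γ| ≤ ξ) :
    robinGap γ ξ ≤ Real.exp (-ξ) := by
  by_contra! hlt
  have hE : 0 < Real.exp (-ξ) := Real.exp_pos _
  rw [lt_robinGap_iff hE] at hlt
  obtain ⟨hγ1, hγ2⟩ := abs_le.1 (show |γ| ≤ ξ / 2 by linarith)
  set c := (ξ - γ) / 2 with hc
  have hb1 : Real.exp (-ξ) ≤ 1 := Real.exp_le_one_iff.2 (by linarith)
  refine absurd (le_cylMean_of_le (b := Real.exp (-ξ) / 2) (c := c) (ξ := ξ) (half_pos hE)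
    (by linarith) (by linarith) (by linarith) ?_) (by linarith)
  have h1 : c ^ (Real.exp (-ξ) / 2) ≤ ξ := by
    calc c ^ (Real.exp (-ξ) / 2) ≤ c ^ (1 : ℝ) :=
          Real.rpow_le_rpow_of_exponent_le (by linarith) (by linarith)
      _ = c := Real.rpow_one c
      _ ≤ ξ := by linarith
  have h2 : ξ ^ 2 ≤ 2 * Real.exp ξ := by
    have := Real.quadratic_le_exp_of_nonneg (show 0 ≤ ξ by linarith)
    linarith
  have h3 : 1 / 8 ≤ (ξ - c) / (ξ + 1) := by
    rw [le_div_iff₀ (by linarith)]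
    linarith
  have h4 : (32 : ℝ) ≤ Real.exp 5 := by
    have := Real.add_one_le_exp (1 : ℝ)
    calc (32 : ℝ) = 2 ^ 5 := by norm_num
      _ ≤ Real.exp 1 ^ 5 := by gcongr; linarith
      _ = Real.exp 5 := by rw [← Real.exp_nat_mul]; norm_num
  have hc0 : 0 < c := by linarith
  have h5 : c ^ (Real.exp (-ξ) / 2) / (Real.exp (-ξ) / 2) ≤ 2 * ξ * Real.exp ξ := by
    rw [div_le_iff₀ (half_pos hE)]
    have : Real.exp ξ * Real.exp (-ξ) = 1 := by rw [← Real.exp_add]; simp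
    linear_combination h1 - ξ * this
  calc c * Real.exp (2 * ξ * c - c ^ 2) * (c ^ (Real.exp (-ξ) / 2) / (Real.exp (-ξ) / 2))
      ≤ ξ * Real.exp (2 * ξ * c - c ^ 2) * (2 * ξ * Real.exp ξ) := by
        gcongr
        linarith
    _ = 2 * ξ ^ 2 * Real.exp (2 * ξ * c - c ^ 2 + ξ) := by rw [Real.exp_add]; ring
    _ ≤ 2 * (2 * Real.exp ξ) * Real.exp (2 * ξ * c - c ^ 2 + ξ) := by gcongr
    _ = 1 / 8 * (32 * Real.exp (2 * ξ * c - c ^ 2 + ξ + ξ)) := by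
        rw [Real.exp_add (2 * ξ * c - c ^ 2 + ξ) ξ]; ring
    _ ≤ 1 / 8 * (Real.exp 5 * Real.exp (2 * ξ * c - c ^ 2 + ξ + ξ)) := by gcongr
    _ = 1 / 8 * Real.exp (5 + (2 * ξ * c - c ^ 2 + ξ + ξ)) := by rw [← Real.exp_add]
    _ ≤ (ξ - c) / (ξ + 1) * Real.exp (ξ ^ 2 - 1) := by
        gcongr
        -- `ξ² - (2ξc - c²) = (ξ - c)² ≥ ξ² / 16`, which beats `2ξ + 6` for `ξ ≥ 40`.
        have : ξ / 4 ≤ ξ - c := by linarith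
        nlinarith

lemma integrable_robinGap (γ : ℝ) : Integrable (robinGap γ) := by
  have hc : Continuous (robinGap γ) :=
    continuous_robinGap.comp (by fun_prop : Continuous fun ξ => (γ, ξ))
  rw [← integrableOn_univ, ← Iic_union_Ioi (a := γ), integrableOn_union]
  constructor
  · exact integrableOn_zero.congr_fun (fun ξ hξ => (robinGap_of_le hξ).symm) measurableSet_Iic
  · refine integrable_of_isBigO_exp_neg one_pos hc.continuousOn (Asymptotics.IsBigO.of_bound 1 ?_)
    filter_upwards [eventually_ge_atTop 40, eventually_ge_atTop (2 * |γ|)] with ξ h1 h2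
    rw [Real.norm_of_nonneg (robinGap_nonneg γ ξ), Real.norm_of_nonneg (Real.exp_pos _).le]
    simpa using robinGap_le_exp_neg h1 h2

lemma continuous_integral_robinGap : Continuous fun γ => ∫ ξ, robinGap γ ξ := by
  refine continuous_iff_continuousAt.2 fun γ => ?_
  -- Monotonicity in `γ` makes `robinGap (γ - 1)` a dominating function near `γ`.
  refine continuousAt_of_dominated (bound := robinGap (γ - 1))
    (Eventually.of_forall fun γ' => (integrable_robinGap γ').aestronglyMeasurable) ?_
    (integrable_robinGap _) (Eventually.of_forall fun ξ => ?_)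
  · filter_upwards [Ioi_mem_nhds (show γ - 1 < γ by linarith)] with γ' hγ'
    refine Eventually.of_forall fun ξ => ?_
    rw [Real.norm_of_nonneg (robinGap_nonneg _ _)]
    exact robinGap_antitone ξ (le_of_lt hγ')
  · exact (continuous_robinGap.comp (by fun_prop : Continuous fun γ' => (γ', ξ))).continuousAt

/-! ### The explicit eigenfunctions -/

/-- The solution `e^{-(t-ξ)²/2} M_b(ξ - t)` of `-v'' + (t - ξ)² v = (1 - 2b) v`, positive on `ℝ` and
decaying at `+∞`. -/
noncomputable def cylSol (b ξ t : ℝ) : ℝ := Real.exp (-(t - ξ) ^ 2 / 2) * cylMoment b (ξ - t)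

/-- The derivative of `cylSol b ξ`. -/
noncomputable def cylSolDeriv (b ξ t : ℝ) : ℝ :=
  -(t - ξ) * cylSol b ξ t - 2 * cylSol (b + 1) ξ t

lemma cylSol_pos {b : ℝ} (hb : 0 < b) (ξ t : ℝ) : 0 < cylSol b ξ t :=
  mul_pos (Real.exp_pos _) (cylMoment_pos hb _)

lemma hasDerivAt_cylSol {b : ℝ} (hb : 0 < b) (ξ t : ℝ) :
    HasDerivAt (cylSol b ξ) (cylSolDeriv b ξ t) t := by
  have h1 : HasDerivAt (fun t : ℝ => -(t - ξ) ^ 2 / 2) (-(t - ξ)) t := by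
    refine ((((hasDerivAt_id t).sub_const ξ).pow 2).neg.div_const 2).congr_deriv ?_
    norm_num
    ring
  have h2 := (hasDerivAt_cylMoment hb (ξ - t)).comp t ((hasDerivAt_id t).const_sub ξ)
  refine (h1.exp.mul h2).congr_deriv ?_
  simp only [cylSolDeriv, cylSol, Function.comp]
  ring

lemma hasDerivAt_cylSolDeriv {b : ℝ} (hb : 0 < b) (ξ t : ℝ) :
    HasDerivAt (cylSolDeriv b ξ) (((t - ξ) ^ 2 - (1 - 2 * b)) * cylSol b ξ t) t := by
  have h1 := (((hasDerivAt_id t).sub_const ξ).neg.mul (hasDerivAt_cylSol hb ξ t)).sub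
    ((hasDerivAt_cylSol (show 0 < b + 1 by linarith) ξ t).const_mul 2)
  refine h1.congr_deriv ?_
  have h := cylMoment_recurrence hb (ξ - t)
  simp only [cylSolDeriv, cylSol, id, Pi.neg_apply, show b + 1 + 1 = b + 2 by ring]
  linear_combination (-2 * Real.exp (-(t - ξ) ^ 2 / 2)) * h

lemma cylSolDeriv_zero {b : ℝ} (hb : 0 < b) (ξ : ℝ) :
    cylSolDeriv b ξ 0 = (ξ - 2 * cylMean b ξ) * cylSol b ξ 0 := by
  simp only [cylSolDeriv, cylSol, sub_zero, cylMoment_add_one hb]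
  ring

lemma continuous_cylSol {b : ℝ} (hb : 0 < b) (ξ : ℝ) : Continuous (cylSol b ξ) :=
  continuous_iff_continuousAt.2 fun t => (hasDerivAt_cylSol hb ξ t).continuousAt

lemma continuous_cylSolDeriv {b : ℝ} (hb : 0 < b) (ξ : ℝ) : Continuous (cylSolDeriv b ξ) :=
  continuous_iff_continuousAt.2 fun t => (hasDerivAt_cylSolDeriv hb ξ t).continuousAt

lemma memLp_pow_mul_cylSol {b : ℝ} (hb : 0 < b) (ξ : ℝ) (k : ℕ) :
    MemLp (fun t => t ^ k * cylSol b ξ t) 2 (volume.restrict (Ioi 0)) := by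
  have hc : Continuous fun t => t ^ k * cylSol b ξ t := by
    have := continuous_cylSol hb ξ
    fun_prop
  rw [memLp_two_iff_integrable_sq hc.aestronglyMeasurable]
  -- For `t ≥ 0` the moment is at most its value at `t = 0`, and the Gaussian is `O(e^{-2t})`.
  have h1 : cylSol b ξ =O[atTop] fun t => Real.exp (-2 * t) := by
    refine Asymptotics.IsBigO.of_bound (Real.exp (2 * ξ + 2) * cylMoment b ξ) ?_
    filter_upwards [eventually_ge_atTop 0] with t ht
    rw [Real.norm_of_nonneg (cylSol_pos hb ξ t).le, Real.norm_of_nonneg (Real.exp_pos _).le,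
      cylSol]
    have h2 := cylMoment_mono hb (show ξ - t ≤ ξ by linarith)
    have h3 : Real.exp (-(t - ξ) ^ 2 / 2) ≤ Real.exp (2 * ξ + 2) * Real.exp (-2 * t) := by
      rw [← Real.exp_add]
      refine Real.exp_le_exp.2 ?_
      nlinarith [sq_nonneg (t - ξ - 2)]
    calc _ ≤ (Real.exp (2 * ξ + 2) * Real.exp (-2 * t)) * cylMoment b ξ :=
          mul_le_mul h3 h2 (cylMoment_pos hb _).le (by positivity)
      _ = _ := by ring
  have h2 : (fun t : ℝ => t ^ k) =O[atTop] fun t => Real.exp t :=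
    (Real.isLittleO_pow_exp_atTop (n := k)).isBigO
  have h3 := (h2.mul h1).pow 2
  refine integrable_of_isBigO_exp_neg (b := 2) two_pos (hc.pow 2).continuousOn ?_
  refine h3.congr_right fun t => ?_
  rw [← Real.exp_add, ← Real.exp_nat_mul]
  congr 1
  push_cast
  ring

lemma memLp_cylSol {b : ℝ} (hb : 0 < b) (ξ : ℝ) :
    MemLp (cylSol b ξ) 2 (volume.restrict (Ioi 0)) := by
  simpa using memLp_pow_mul_cylSol hb ξ 0

lemma memLp_pow_mul_cylSolDeriv {b : ℝ} (hb : 0 < b) (ξ : ℝ) (k : ℕ) :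
    MemLp (fun t => t ^ k * cylSolDeriv b ξ t) 2 (volume.restrict (Ioi 0)) := by
  have h := (((memLp_pow_mul_cylSol hb ξ k).const_mul ξ).sub
    (memLp_pow_mul_cylSol hb ξ (k + 1))).sub
    ((memLp_pow_mul_cylSol (show 0 < b + 1 by linarith) ξ k).const_mul 2)
  refine h.ae_eq (Eventually.of_forall fun t => ?_)
  simp only [Pi.sub_apply, cylSolDeriv]
  ring

lemma memLp_cylSolDeriv {b : ℝ} (hb : 0 < b) (ξ : ℝ) :
    MemLp (cylSolDeriv b ξ) 2 (volume.restrict (Ioi 0)) := by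
  simpa using memLp_pow_mul_cylSolDeriv hb ξ 0

lemma memLp_cylSolDeriv_deriv {b : ℝ} (hb : 0 < b) (ξ : ℝ) :
    MemLp (fun t => ((t - ξ) ^ 2 - (1 - 2 * b)) * cylSol b ξ t) 2 (volume.restrict (Ioi 0)) := by
  have h := ((memLp_pow_mul_cylSol hb ξ 2).sub
    ((memLp_pow_mul_cylSol hb ξ 1).const_mul (2 * ξ))).add
    ((memLp_cylSol hb ξ).const_mul (ξ ^ 2 - (1 - 2 * b)))
  refine h.ae_eq (Eventually.of_forall fun t => ?_)
  simp only [Pi.sub_apply, Pi.add_apply]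
  ring

/-- Integration by parts against a test function on `(0, ∞)`. -/
lemma setIntegral_Ioi_deriv_smul {f f' : ℝ → ℂ} (hf : ∀ t, HasDerivAt f (f' t) t)
    (hf' : Continuous f') {φ : ℝ → ℝ} (hφ : ContDiff ℝ ∞ φ) (hcs : HasCompactSupport φ)
    (hs : tsupport φ ⊆ Ioi 0) :
    ∫ t in Ioi (0 : ℝ), deriv φ t • f t = -∫ t in Ioi (0 : ℝ), φ t • f' t := by
  have hfc : Continuous f := continuous_iff_continuousAt.2 fun t => (hf t).continuousAt
  have hd : Continuous (deriv φ) := hφ.continuous_deriv (by simp)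
  have z1 : ∀ t, t ∉ Ioi (0 : ℝ) → φ t = 0 := fun t ht =>
    image_eq_zero_of_notMem_tsupport fun h => ht (hs h)
  have z2 : ∀ t, t ∉ Ioi (0 : ℝ) → deriv φ t = 0 := fun t ht =>
    image_eq_zero_of_notMem_tsupport fun h => ht (hs (tsupport_deriv_subset h))
  rw [setIntegral_eq_integral_of_forall_compl_eq_zero fun t ht => by rw [z2 t ht, zero_smul],
    setIntegral_eq_integral_of_forall_compl_eq_zero fun t ht => by rw [z1 t ht, zero_smul]]
  have h := integral_bilinear_hasDerivAt_right_eq_neg_left_of_integrable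
    (L := ContinuousLinearMap.lsmul ℝ ℝ (E := ℂ)) (u := φ) (v := f) (u' := deriv φ) (v' := f')
    (fun t _ => (hφ.differentiable (by simp) t).hasDerivAt) (fun t _ => hf t)
    ((hφ.continuous.smul hf').integrable_of_hasCompactSupport hcs.smul_right)
    ((hd.smul hfc).integrable_of_hasCompactSupport hcs.deriv.smul_right)
    ((hφ.continuous.smul hfc).integrable_of_hasCompactSupport hcs.smul_right)
  simp only [ContinuousLinearMap.lsmul_apply] at h
  rw [h, neg_neg]

lemma isWeakDeriv_zero (u : L2Half) : IsWeakDeriv 0 u u := by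
  intro φ _ _ _
  simp

lemma isWeakDeriv_one_of_hasDerivAt {f f' : ℝ → ℂ} (hf : ∀ t, HasDerivAt f (f' t) t)
    (hf' : Continuous f') {u v : L2Half} (hu : u =ᵐ[volume.restrict (Ioi 0)] f)
    (hv : v =ᵐ[volume.restrict (Ioi 0)] f') : IsWeakDeriv 1 u v := by
  intro φ hφ hcs hs
  have e1 : ∫ t in Ioi (0 : ℝ), iteratedDeriv 1 φ t • u t
      = ∫ t in Ioi (0 : ℝ), deriv φ t • f t := by
    refine integral_congr_ae ?_
    filter_upwards [hu] with t ht
    rw [ht, iteratedDeriv_one]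
  have e2 : ∫ t in Ioi (0 : ℝ), φ t • v t = ∫ t in Ioi (0 : ℝ), φ t • f' t := by
    refine integral_congr_ae ?_
    filter_upwards [hv] with t ht
    rw [ht]
  rw [e1, e2, setIntegral_Ioi_deriv_smul hf hf' hφ hcs hs]
  ring

lemma IsWeakDeriv.integral_deriv_smul {u v : L2Half} (h : IsWeakDeriv 1 u v) {φ : ℝ → ℝ}
    (hφ : ContDiff ℝ ∞ φ) (hcs : HasCompactSupport φ) (hs : tsupport φ ⊆ Ioi 0) :
    ∫ t in Ioi (0 : ℝ), deriv φ t • u t = -∫ t in Ioi (0 : ℝ), φ t • v t := by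
  have := h φ hφ hcs hs
  rw [iteratedDeriv_one] at this
  rw [this]
  ring

lemma IsWeakDeriv.integral_deriv_deriv_smul {u v : L2Half} (h : IsWeakDeriv 1 u v) {φ : ℝ → ℝ}
    (hφ : ContDiff ℝ ∞ φ) (hcs : HasCompactSupport φ) (hs : tsupport φ ⊆ Ioi 0) :
    ∫ t in Ioi (0 : ℝ), iteratedDeriv 2 φ t • u t = -∫ t in Ioi (0 : ℝ), deriv φ t • v t := by
  have e : iteratedDeriv 2 φ = deriv (deriv φ) := by
    rw [iteratedDeriv_succ, iteratedDeriv_one]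
  rw [e]
  exact h.integral_deriv_smul (hφ.iterate_deriv 1) hcs.deriv (tsupport_deriv_subset.trans hs)

/-- The weak derivative of a weak derivative is the second weak derivative. -/
lemma IsWeakDeriv.two_of_one_one {u v w : L2Half} (h₁ : IsWeakDeriv 1 u v)
    (h₂ : IsWeakDeriv 1 v w) : IsWeakDeriv 2 u w := by
  intro φ hφ hcs hs
  rw [h₁.integral_deriv_deriv_smul hφ hcs hs, h₂.integral_deriv_smul hφ hcs hs]
  ring

/-- The restriction of `cylSol b ξ` to `(0, ∞)` as an element of `L²(ℝ₊)`. -/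
noncomputable def cylSolLp {b : ℝ} (hb : 0 < b) (ξ : ℝ) : L2Half :=
  (memLp_cylSol hb ξ).ofReal (K := ℂ).toLp

lemma coeFn_cylSolLp {b : ℝ} (hb : 0 < b) (ξ : ℝ) :
    cylSolLp hb ξ =ᵐ[volume.restrict (Ioi 0)] fun t => (cylSol b ξ t : ℂ) :=
  MemLp.coeFn_toLp _

lemma cylSolLp_ne_zero {b : ℝ} (hb : 0 < b) (ξ : ℝ) : cylSolLp hb ξ ≠ 0 := by
  intro h
  have h1 : ∀ᵐ _ ∂(volume.restrict (Ioi (0 : ℝ))), False := by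
    filter_upwards [coeFn_cylSolLp hb ξ, Lp.coeFn_zero ℂ 2 (volume.restrict (Ioi (0 : ℝ)))]
      with t h1 h2
    rw [h, h2] at h1
    exact (cylSol_pos hb ξ t).ne' (by simpa using h1.symm)
  rw [ae_iff] at h1
  simp at h1

/-- If `2 R_b(ξ) = ξ - γ`, then `cylSol b ξ` satisfies the Robin condition and is an eigenfunction
with eigenvalue `1 - 2b`. -/
theorem isRobinEigenvector_cylSolLp {b γ ξ : ℝ} (hb : 0 < b) (h : 2 * cylMean b ξ = ξ - γ) :
    IsRobinEigenvector γ ξ (1 - 2 * b) (cylSolLp hb ξ) := by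
  set v₁ : L2Half := (memLp_cylSolDeriv hb ξ).ofReal (K := ℂ).toLp
  set v₂ : L2Half := (memLp_cylSolDeriv_deriv hb ξ).ofReal (K := ℂ).toLp
  have e₀ := coeFn_cylSolLp hb ξ
  have e₁ : v₁ =ᵐ[volume.restrict (Ioi 0)] fun t => (cylSolDeriv b ξ t : ℂ) :=
    MemLp.coeFn_toLp _
  have e₂ : v₂ =ᵐ[volume.restrict (Ioi 0)]
      fun t => ((((t - ξ) ^ 2 - (1 - 2 * b)) * cylSol b ξ t : ℝ) : ℂ) := MemLp.coeFn_toLp _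
  have c₀ := continuous_cylSol hb ξ
  have c₁ := continuous_cylSolDeriv hb ξ
  have d₁ : IsWeakDeriv 1 (cylSolLp hb ξ) v₁ :=
    isWeakDeriv_one_of_hasDerivAt (fun t => (hasDerivAt_cylSol hb ξ t).ofReal_comp)
      (by fun_prop) e₀ e₁
  have d₂ : IsWeakDeriv 1 v₁ v₂ :=
    isWeakDeriv_one_of_hasDerivAt (fun t => (hasDerivAt_cylSolDeriv hb ξ t).ofReal_comp)
      (by fun_prop) e₁ e₂
  have d : IsWeakDeriv 2 (cylSolLp hb ξ) v₂ := d₁.two_of_one_one d₂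
  refine ⟨cylSolLp_ne_zero hb ξ, ⟨?_, v₁, cylSol b ξ 0, d₁, ?_, ?_⟩, v₂, d, ?_⟩
  · intro q hq
    interval_cases q
    · refine ⟨cylSolLp hb ξ, isWeakDeriv_zero _, fun p _ => ?_⟩
      refine ((memLp_pow_mul_cylSol hb ξ p).ofReal (K := ℂ)).ae_eq ?_
      filter_upwards [e₀] with t ht
      simp [ht]
    · refine ⟨v₁, d₁, fun p _ => ?_⟩
      refine ((memLp_pow_mul_cylSolDeriv hb ξ p).ofReal (K := ℂ)).ae_eq ?_
      filter_upwards [e₁] with t ht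
      simp [ht]
    · refine ⟨v₂, d, fun p hp => ?_⟩
      obtain rfl : p = 0 := by omega
      simpa using Lp.memLp v₂
  · exact ⟨fun t => (cylSol b ξ t : ℂ), by fun_prop, e₀, rfl⟩
  · refine ⟨fun t => (cylSolDeriv b ξ t : ℂ), by fun_prop, e₁, ?_⟩
    change ((cylSolDeriv b ξ 0 : ℝ) : ℂ) = γ * cylSol b ξ 0
    rw [cylSolDeriv_zero hb, h, sub_sub_cancel, Complex.ofReal_mul]
  · filter_upwards [e₀, e₂, Lp.coeFn_smul ((1 - 2 * b : ℝ) : ℂ) (cylSolLp hb ξ)] with t h₀ h₂ h₃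
    rw [h₃, Pi.smul_apply, h₀, h₂]
    simp only [smul_eq_mul, Complex.real_smul]
    push_cast
    ring

/-! ### Eigenfunctions below one are multiples of the explicit ones -/

/-- A test function on `(0, ∞)` with integral zero is the derivative of a test function on
`(0, ∞)`. -/
lemma exists_deriv_eq_of_integral_eq_zero {ψ : ℝ → ℝ} (hψ : ContDiff ℝ ∞ ψ)
    (hcs : HasCompactSupport ψ) (hs : tsupport ψ ⊆ Ioi 0) (h0 : ∫ t, ψ t = 0) :
    ∃ Φ : ℝ → ℝ, ContDiff ℝ ∞ Φ ∧ HasCompactSupport Φ ∧ tsupport Φ ⊆ Ioi 0 ∧ deriv Φ = ψ := by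
  have hK : IsCompact (tsupport ψ ∪ {1}) := IsCompact.union hcs isCompact_singleton
  have hne : (tsupport ψ ∪ {1}).Nonempty := ⟨1, Or.inr rfl⟩
  obtain ⟨a, haK, ha⟩ := hK.exists_isLeast hne
  obtain ⟨b, hbK, hb⟩ := hK.exists_isGreatest hne
  have ha0 : 0 < a := by
    rcases haK with h | h
    · exact hs h
    · rw [mem_singleton_iff.1 h]; exact one_pos
  have hza : ∀ t, t < a → ψ t = 0 := fun t ht =>
    image_eq_zero_of_notMem_tsupport fun h => (ha (Or.inl h)).not_gt ht
  have hzb : ∀ t, b < t → ψ t = 0 := fun t ht =>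
    image_eq_zero_of_notMem_tsupport fun h => (hb (Or.inl h)).not_gt ht
  have hd : ∀ t, HasDerivAt (fun t => ∫ s in (0 : ℝ)..t, ψ s) (ψ t) t := fun t =>
    intervalIntegral.integral_hasDerivAt_right (hψ.continuous.intervalIntegrable _ _)
      (hψ.continuous.stronglyMeasurableAtFilter _ _) hψ.continuous.continuousAt
  have hd' : deriv (fun t => ∫ s in (0 : ℝ)..t, ψ s) = ψ := funext fun t => (hd t).deriv
  have hsupp : Function.support (fun t => ∫ s in (0 : ℝ)..t, ψ s) ⊆ Icc a b := by
    intro t ht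
    by_contra hnot
    refine ht ?_
    rcases lt_or_ge t a with hta | hta
    · refine (intervalIntegral.integral_congr (g := fun _ => (0 : ℝ)) fun s hs' => ?_).trans
        (by simp)
      refine hza s (lt_of_le_of_lt hs'.2 ?_)
      exact max_lt ha0 hta
    · have htb : b < t := lt_of_not_ge fun h => hnot ⟨hta, h⟩
      change ∫ s in (0 : ℝ)..t, ψ s = 0
      rw [intervalIntegral.integral_of_le (ha0.le.trans hta)]
      refine (setIntegral_eq_integral_of_forall_compl_eq_zero fun s hs' => ?_).trans h0
      rcases lt_or_ge s a with h | h
      · exact hza s h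
      · exact hzb s (htb.trans (lt_of_not_ge fun h' => hs' ⟨ha0.trans_le h, h'⟩))
  refine ⟨fun t => ∫ s in (0 : ℝ)..t, ψ s, ?_, ?_, ?_, hd'⟩
  · exact contDiff_infty_iff_deriv.2 ⟨fun t => (hd t).differentiableAt, by rwa [hd']⟩
  · exact HasCompactSupport.of_support_subset_isCompact isCompact_Icc hsupp
  · exact (closure_minimal hsupp isClosed_Icc).trans fun t ht => ha0.trans_le ht.1

/-- The lemma of du Bois-Reymond for continuous functions on `(0, ∞)`. -/
lemma exists_eqOn_const_of_integral_deriv_smul_eq_zero {h : ℝ → ℂ} (hc : Continuous h)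
    (H : ∀ φ : ℝ → ℝ, ContDiff ℝ ∞ φ → HasCompactSupport φ → tsupport φ ⊆ Ioi 0 →
      ∫ t in Ioi (0 : ℝ), deriv φ t • h t = 0) : ∃ C : ℂ, EqOn h (fun _ => C) (Ioi 0) := by
  let f : ContDiffBump (2 : ℝ) := ⟨1 / 2, 1, by norm_num, by norm_num⟩
  set ρ : ℝ → ℝ := f.normed volume with hρ
  have ρd : ContDiff ℝ ∞ ρ := f.contDiff_normed
  have ρc : HasCompactSupport ρ := f.hasCompactSupport_normed
  have ρs : tsupport ρ ⊆ Ioi 0 := by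
    rw [hρ, f.tsupport_normed_eq]
    intro t ht
    have := (abs_le.1 (show |t - 2| ≤ 1 from ht)).1
    exact show 0 < t by linarith
  have ρi : ∫ t, ρ t = 1 := f.integral_normed
  have key : ∀ φ : ℝ → ℝ, ContDiff ℝ ∞ φ → HasCompactSupport φ → tsupport φ ⊆ Ioi 0 →
      ∫ t in Ioi (0 : ℝ), φ t • (h t - ∫ s in Ioi (0 : ℝ), ρ s • h s) = 0 := by
    intro φ φd φc φs
    have iφ : Integrable φ := φd.continuous.integrable_of_hasCompactSupport φc
    have iρ : Integrable ρ := ρd.continuous.integrable_of_hasCompactSupport ρc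
    have iφh : Integrable fun t => φ t • h t :=
      (φd.continuous.smul hc).integrable_of_hasCompactSupport φc.smul_right
    have iρh : Integrable fun t => ρ t • h t :=
      (ρd.continuous.smul hc).integrable_of_hasCompactSupport ρc.smul_right
    have hm : ∫ t in Ioi (0 : ℝ), φ t = ∫ t, φ t :=
      setIntegral_eq_integral_of_forall_compl_eq_zero fun t ht =>
        image_eq_zero_of_notMem_tsupport fun h => ht (φs h)
    set m := ∫ t, φ t with hm'
    obtain ⟨Φ, Φd, Φc, Φs, Φe⟩ := exists_deriv_eq_of_integral_eq_zero
      (ψ := φ - fun t => m * ρ t) (φd.sub (contDiff_const.mul ρd))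
      (φc.sub ρc.mul_left)
      ((tsupport_sub φ _).trans (union_subset φs ((tsupport_mul_subset_right).trans ρs)))
      (by
        simp only [Pi.sub_apply]
        rw [integral_sub iφ (iρ.const_mul m), integral_const_mul, ρi, mul_one, sub_self])
    have hz := H Φ Φd Φc Φs
    rw [Φe] at hz
    have e1 : ∫ t in Ioi (0 : ℝ), (φ - fun t => m * ρ t) t • h t
        = (∫ t in Ioi (0 : ℝ), φ t • h t) - m • ∫ t in Ioi (0 : ℝ), ρ t • h t := by
      have iρm : Integrable (fun t => m • ρ t • h t) (volume.restrict (Ioi 0)) :=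
        iρh.integrableOn.smul m
      rw [← integral_smul, ← integral_sub iφh.integrableOn iρm]
      refine integral_congr_ae (Eventually.of_forall fun t => ?_)
      simp only [Pi.sub_apply, sub_smul, mul_smul]
    simp only [smul_sub]
    rw [integral_sub iφh.integrableOn (iφ.integrableOn.smul_const _), integral_smul_const, hm, ← e1]
    exact hz
  refine ⟨∫ s in Ioi (0 : ℝ), ρ s • h s, ?_⟩
  have hc' : Continuous fun t => h t - ∫ s in Ioi (0 : ℝ), ρ s • h s := by fun_prop
  have hae := isOpen_Ioi.ae_eq_zero_of_integral_contDiff_smul_eq_zero (μ := volume)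
    (hc'.locallyIntegrable.locallyIntegrableOn _) (U := Ioi (0 : ℝ)) fun φ φd φc φs => by
      rw [← key φ φd φc φs]
      refine (setIntegral_eq_integral_of_forall_compl_eq_zero fun t ht => ?_).symm
      rw [image_eq_zero_of_notMem_tsupport fun h => ht (φs h), zero_smul]
  have hae' : h =ᵐ[volume.restrict (Ioi 0)] fun _ => ∫ s in Ioi (0 : ℝ), ρ s • h s := by
    filter_upwards [ae_restrict_of_ae hae, ae_restrict_mem measurableSet_Ioi] with t h1 h2
    exact sub_eq_zero.1 (h1 h2)
  exact Measure.eqOn_open_of_ae_eq hae' isOpen_Ioi hc.continuousOn continuousOn_const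

/-- A continuous function with continuous weak derivative is classically differentiable. -/
lemma IsWeakDeriv.hasDerivAt {u v : L2Half} (h : IsWeakDeriv 1 u v) {g g₁ : ℝ → ℂ}
    (hg : Continuous g) (hg₁ : Continuous g₁) (hu : u =ᵐ[volume.restrict (Ioi 0)] g)
    (hv : v =ᵐ[volume.restrict (Ioi 0)] g₁) {t : ℝ} (ht : 0 < t) : HasDerivAt g (g₁ t) t := by
  have hk : ∀ t, HasDerivAt (fun t => ∫ s in (0 : ℝ)..t, g₁ s) (g₁ t) t := fun t =>
    intervalIntegral.integral_hasDerivAt_right (hg₁.intervalIntegrable _ _)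
      (hg₁.stronglyMeasurableAtFilter _ _) hg₁.continuousAt
  have hkc : Continuous fun t => ∫ s in (0 : ℝ)..t, g₁ s :=
    continuous_iff_continuousAt.2 fun t => (hk t).continuousAt
  obtain ⟨C, hC⟩ := exists_eqOn_const_of_integral_deriv_smul_eq_zero
    (h := fun t => g t - ∫ s in (0 : ℝ)..t, g₁ s) (hg.sub hkc) fun φ φd φc φs => by
      have h1 := h.integral_deriv_smul φd φc φs
      have e1 : ∫ t in Ioi (0 : ℝ), deriv φ t • u t = ∫ t in Ioi (0 : ℝ), deriv φ t • g t :=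
        integral_congr_ae (by filter_upwards [hu] with t ht; rw [ht])
      have e2 : ∫ t in Ioi (0 : ℝ), φ t • v t = ∫ t in Ioi (0 : ℝ), φ t • g₁ t :=
        integral_congr_ae (by filter_upwards [hv] with t ht; rw [ht])
      have hd : Continuous (deriv φ) := φd.continuous_deriv (by simp)
      have i1 : Integrable fun t => deriv φ t • g t :=
        (hd.smul hg).integrable_of_hasCompactSupport φc.deriv.smul_right
      have i2 : Integrable fun t => deriv φ t • ∫ s in (0 : ℝ)..t, g₁ s :=
        (hd.smul hkc).integrable_of_hasCompactSupport φc.deriv.smul_right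
      simp only [smul_sub]
      rw [integral_sub i1.integrableOn i2.integrableOn, setIntegral_Ioi_deriv_smul hk hg₁ φd φc φs,
        ← e1, h1, e2, sub_self]
  have hev : g =ᶠ[𝓝 t] fun t => C + ∫ s in (0 : ℝ)..t, g₁ s := by
    filter_upwards [Ioi_mem_nhds ht] with s hs
    have := hC hs
    simp only at this
    rw [← this]
    ring
  exact ((hk t).const_add C).congr_of_eventuallyEq hev

lemma exists_continuous_eqOn_Ici {g : ℝ → ℂ} (hg : ContinuousOn g (Ici 0)) :
    ∃ f : ℝ → ℂ, Continuous f ∧ EqOn f g (Ici 0) :=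
  ⟨fun t => g (max t 0), hg.comp_continuous (by fun_prop) fun t => le_max_right t 0,
    fun t ht => by simp only [max_eq_left (show (0 : ℝ) ≤ t from ht)]⟩

lemma HasTrace.exists_continuous {u : L2Half} {a : ℂ} (h : HasTrace u a) :
    ∃ g : ℝ → ℂ, Continuous g ∧ u =ᵐ[volume.restrict (Ioi 0)] g ∧ g 0 = a := by
  obtain ⟨g, hg, hu, h0⟩ := h
  obtain ⟨f, hf, hfg⟩ := exists_continuous_eqOn_Ici hg
  refine ⟨f, hf, ?_, (hfg self_mem_Ici).trans h0⟩
  filter_upwards [hu, ae_restrict_mem measurableSet_Ioi] with t h1 h2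
  rw [h1, hfg (mem_Ici.2 (le_of_lt h2))]

/-- A function with zero derivative on `(0, ∞)` is constant up to the endpoint `0`. -/
lemma eq_of_hasDerivAt_zero_of_pos {f : ℝ → ℂ} (hc : Continuous f)
    (hd : ∀ t, 0 < t → HasDerivAt f 0 t) {t : ℝ} (ht : 0 ≤ t) : f t = f 0 := by
  have h1 : EqOn f (fun _ => f 1) (Ioi 0) := by
    intro s hs
    refine (convex_Ioi (0 : ℝ)).is_const_of_fderivWithin_eq_zero (𝕜 := ℝ)
      (fun x hx => (hd x hx).differentiableAt.differentiableWithinAt) (fun x hx => ?_) hs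
      (show (0 : ℝ) < 1 from one_pos)
    rw [fderivWithin_of_isOpen isOpen_Ioi hx]
    ext
    simpa using (hd x hx).deriv
  have h2 : EqOn f (fun _ => f 1) (closure (Ioi 0)) := h1.closure hc continuous_const
  rw [closure_Ioi] at h2
  rw [h2 ht, h2 self_mem_Ici]

/-- An eigenfunction with eigenvalue `1 - 2b < 1` is a multiple of the explicit solution. Its
Wronskian with `cylSol b ξ` is constant, and integrable as a product of `L²` functions, so it
vanishes; hence the quotient by the positive function `cylSol b ξ` is constant. -/
theorem IsRobinEigenvector.eq_smul_cylSolLp {b γ ξ : ℝ} (hb : 0 < b) {u : L2Half}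
    (hu : IsRobinEigenvector γ ξ (1 - 2 * b) u) :
    2 * cylMean b ξ = ξ - γ ∧ ∃ c : ℂ, u = c • cylSolLp hb ξ := by
  obtain ⟨hne, ⟨-, u', a, h1, htr, htr'⟩, u'', h2, heq⟩ := hu
  obtain ⟨g, hg, hug, hga⟩ := htr.exists_continuous
  obtain ⟨g₁, hg₁, hug₁, hga₁⟩ := htr'.exists_continuous
  have h3 : IsWeakDeriv 1 u' u'' := by
    intro φ φd φc φs
    have e1 := h1.integral_deriv_deriv_smul φd φc φs
    have e2 := h2 φ φd φc φs
    rw [iteratedDeriv_one]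
    rw [e1] at e2
    linear_combination -e2
  have hug₂ : u'' =ᵐ[volume.restrict (Ioi 0)]
      fun t => (((t - ξ) ^ 2 - (1 - 2 * b) : ℝ) : ℂ) * g t := by
    filter_upwards [heq, hug, Lp.coeFn_smul ((1 - 2 * b : ℝ) : ℂ) u] with t e1 e2 e3
    rw [e3, Pi.smul_apply, e2] at e1
    simp only [smul_eq_mul, Complex.real_smul] at e1
    push_cast at e1 ⊢
    linear_combination e1
  have hd : ∀ t, 0 < t → HasDerivAt g (g₁ t) t := fun t ht => h1.hasDerivAt hg hg₁ hug hug₁ ht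
  have hd₁ : ∀ t, 0 < t → HasDerivAt g₁ ((((t - ξ) ^ 2 - (1 - 2 * b) : ℝ) : ℂ) * g t) t :=
    fun t ht => h3.hasDerivAt hg₁ (by fun_prop) hug₁ hug₂ ht
  have c₀ := continuous_cylSol hb ξ
  have c₁ := continuous_cylSolDeriv hb ξ
  have hv := fun t => (hasDerivAt_cylSol hb ξ t).ofReal_comp
  have hv₁ := fun t => (hasDerivAt_cylSolDeriv hb ξ t).ofReal_comp
  have hvne : ∀ t, (cylSol b ξ t : ℂ) ≠ 0 := fun t =>
    Complex.ofReal_ne_zero.2 (cylSol_pos hb ξ t).ne'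
  have hW : ∀ t, 0 ≤ t → g t * cylSolDeriv b ξ t - g₁ t * cylSol b ξ t
      = g 0 * cylSolDeriv b ξ 0 - g₁ 0 * cylSol b ξ 0 := fun t ht =>
    eq_of_hasDerivAt_zero_of_pos
      (f := fun t => g t * cylSolDeriv b ξ t - g₁ t * cylSol b ξ t) (by fun_prop)
      (fun s hs => (((hd s hs).mul (hv₁ s)).sub ((hd₁ s hs).mul (hv s))).congr_deriv
        (by push_cast; ring)) ht
  have hW0 : g 0 * cylSolDeriv b ξ 0 - g₁ 0 * cylSol b ξ 0 = 0 := by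
    have mg : MemLp g 2 (volume.restrict (Ioi 0)) := (Lp.memLp u).ae_eq hug
    have mg₁ : MemLp g₁ 2 (volume.restrict (Ioi 0)) := (Lp.memLp u').ae_eq hug₁
    -- A constant is integrable on the half-line only if it is zero.
    have hi := (mg.integrable_mul ((memLp_cylSolDeriv hb ξ).ofReal (K := ℂ))).sub
      (mg₁.integrable_mul ((memLp_cylSol hb ξ).ofReal (K := ℂ)))
    have hi' : Integrable (fun _ : ℝ => g 0 * cylSolDeriv b ξ 0 - g₁ 0 * cylSol b ξ 0)
        (volume.restrict (Ioi 0)) := by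
      refine hi.congr ?_
      filter_upwards [ae_restrict_mem measurableSet_Ioi] with t ht
      exact hW t (le_of_lt ht)
    refine (integrable_const_iff.1 hi').resolve_right fun hfin => ?_
    have := hfin.measure_univ_lt_top
    simp at this
  have hq : ∀ t, 0 ≤ t → g t = g 0 / cylSol b ξ 0 * cylSol b ξ t := by
    intro t ht
    have := eq_of_hasDerivAt_zero_of_pos (f := fun t => g t / (cylSol b ξ t : ℂ))
      (hg.div (by fun_prop) hvne)
      (fun s hs => ((hd s hs).div (hv s) (hvne s)).congr_deriv (by
        have := hW s hs.le
        rw [hW0] at this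
        rw [show g₁ s * cylSol b ξ s - g s * cylSolDeriv b ξ s = 0 by linear_combination -this,
          zero_div])) ht
    rw [← this, div_mul_cancel₀ _ (hvne t)]
  have hu_eq : u = (g 0 / cylSol b ξ 0) • cylSolLp hb ξ := by
    refine Lp.ext ?_
    filter_upwards [hug, Lp.coeFn_smul (g 0 / cylSol b ξ 0) (cylSolLp hb ξ), coeFn_cylSolLp hb ξ,
      ae_restrict_mem measurableSet_Ioi] with t e1 e2 e3 ht
    rw [e1, e2, Pi.smul_apply, e3, smul_eq_mul, hq t (le_of_lt ht)]
  refine ⟨?_, _, hu_eq⟩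
  have hg0 : g 0 ≠ 0 := by
    intro h
    rw [h, zero_div, zero_smul] at hu_eq
    exact hne hu_eq
  have h4 : g 0 * cylSol b ξ 0 * ((ξ - 2 * cylMean b ξ - γ : ℝ) : ℂ) = 0 := by
    rw [cylSolDeriv_zero hb, hga₁, ← hga] at hW0
    push_cast at hW0 ⊢
    linear_combination hW0
  have h5 := Complex.ofReal_eq_zero.1
    ((mul_eq_zero.1 h4).resolve_left (mul_ne_zero hg0 (hvne 0)))
  linarith

/-! ### The eigenvalues and the integral -/

lemma erealNegPart_of_one_le {x : EReal} (h : 1 ≤ x) : erealNegPart (x - 1) = 0 := by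
  have h' : 0 ≤ x - 1 := (EReal.sub_nonneg (Or.inr (EReal.coe_ne_top 1))
    (Or.inr (EReal.coe_ne_bot 1))).2 h
  rw [erealNegPart, EReal.toENNReal_eq_zero_iff]
  exact EReal.neg_le_zero.2 h'

/-- The only possible eigenvalue below `1` is `1 - robinGap γ ξ`, and it needs `γ < ξ`. -/
lemma IsRobinEigenvector.eq_robinGap {γ ξ ν : ℝ} {u : L2Half} (hν : ν < 1)
    (hu : IsRobinEigenvector γ ξ ν u) : γ < ξ ∧ ν = 1 - robinGap γ ξ := by
  have hb : 0 < (1 - ν) / 2 := by linarith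
  rw [show ν = 1 - 2 * ((1 - ν) / 2) by ring] at hu
  have h := (hu.eq_smul_cylSolLp hb).1
  refine ⟨exists_two_mul_cylMean_eq_iff.1 ⟨_, hb, h⟩, ?_⟩
  rw [robinGap_eq hb h]
  ring

/-- There is at most one eigenvalue below `1`, and it is simple. -/
lemma one_le_robinEigenvalue {j : ℕ} (hj : 2 ≤ j) (γ ξ : ℝ) : 1 ≤ robinEigenvalue j γ ξ := by
  refine le_sInf fun c hc => le_of_not_gt fun hc1 => ?_
  obtain ⟨u, hli, hu⟩ := hc
  have key : ∀ i, γ < ξ ∧ IsRobinEigenvector γ ξ (1 - robinGap γ ξ) (u i) := by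
    intro i
    obtain ⟨ν, hνc, hν⟩ := hu i
    have hν1 : ν < 1 := by exact_mod_cast lt_of_le_of_lt hνc hc1
    obtain ⟨h1, h2⟩ := hν.eq_robinGap hν1
    exact ⟨h1, h2 ▸ hν⟩
  have h0 := key ⟨0, by omega⟩
  have hb : 0 < robinGap γ ξ / 2 := half_pos (robinGap_spec h0.1).1
  have hmul : ∀ i, ∃ c : ℂ, u i = c • cylSolLp hb ξ := by
    intro i
    have := (key i).2
    rw [show 1 - robinGap γ ξ = 1 - 2 * (robinGap γ ξ / 2) by ring] at this
    exact (this.eq_smul_cylSolLp hb).2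
  obtain ⟨c₀, hc₀⟩ := hmul ⟨0, by omega⟩
  obtain ⟨c₁, hc₁⟩ := hmul ⟨1, by omega⟩
  have hpair := hli.comp ![(⟨0, by omega⟩ : Fin j), ⟨1, by omega⟩] (by
    intro a b hab
    fin_cases a <;> fin_cases b <;> simp_all)
  rw [show u ∘ ![(⟨0, by omega⟩ : Fin j), ⟨1, by omega⟩]
      = ![c₀ • cylSolLp hb ξ, c₁ • cylSolLp hb ξ] by
    funext i
    fin_cases i
    · exact hc₀
    · exact hc₁, LinearIndependent.pair_iff] at hpair
  have hz := (hpair c₁ (-c₀) (by rw [smul_smul, smul_smul, ← add_smul]; ring_nf; simp)).2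
  refine hli.ne_zero ⟨0, by omega⟩ ?_
  rw [hc₀, neg_eq_zero.1 hz, zero_smul]

/-- If `γ < ξ` then `μ₁(γ, ξ) = 1 - robinGap γ ξ`, attained by the explicit eigenfunction; otherwise
`μ₁(γ, ξ) ≥ 1` and both sides vanish. -/
lemma erealNegPart_robinEigenvalue_one (γ ξ : ℝ) :
    erealNegPart (robinEigenvalue 1 γ ξ - 1) = ENNReal.ofReal (robinGap γ ξ) := by
  rcases lt_or_ge γ ξ with h | h
  · obtain ⟨h0, h1⟩ := robinGap_spec h
    have he : robinEigenvalue 1 γ ξ = ((1 - robinGap γ ξ : ℝ) : EReal) := by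
      refine le_antisymm (sInf_le ⟨fun _ => cylSolLp (half_pos h0) ξ, ?_, fun _ => ?_⟩)
        (le_sInf fun c hc => ?_)
      · exact LinearIndependent.of_subsingleton 0 (cylSolLp_ne_zero _ _)
      · refine ⟨1 - robinGap γ ξ, le_rfl, ?_⟩
        have := isRobinEigenvector_cylSolLp (half_pos h0) h1
        rwa [mul_div_cancel₀ _ two_ne_zero] at this
      · obtain ⟨u, -, hu⟩ := hc
        obtain ⟨ν, hνc, hν⟩ := hu 0
        refine le_trans ?_ hνc
        rcases lt_or_ge ν 1 with h2 | h2
        · rw [(hν.eq_robinGap h2).2]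
        · exact_mod_cast (by linarith : 1 - robinGap γ ξ ≤ ν)
    have e : (-(((1 - robinGap γ ξ : ℝ) : EReal) - 1)) = ((robinGap γ ξ : ℝ) : EReal) := by
      rw [← EReal.coe_one, ← EReal.coe_sub, ← EReal.coe_neg]
      congr 1
      ring
    rw [he, erealNegPart, e, EReal.toENNReal_of_ne_top (EReal.coe_ne_top _), EReal.toReal_coe]
  · have h1 : 1 ≤ robinEigenvalue 1 γ ξ := by
      refine le_sInf fun c hc => ?_
      obtain ⟨u, -, hu⟩ := hc
      obtain ⟨ν, hνc, hν⟩ := hu 0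
      refine le_trans ?_ hνc
      have : 1 ≤ ν := le_of_not_gt fun h2 => h.not_gt (hν.eq_robinGap h2).1
      exact_mod_cast this
    rw [robinGap_of_le h, ENNReal.ofReal_zero, erealNegPart_of_one_le h1]

lemma robinTerm_of_two_le {j : ℕ} (hj : 2 ≤ j) (γ : ℝ) : robinTerm j γ = 0 := by
  simp [robinTerm, erealNegPart_of_one_le (one_le_robinEigenvalue hj γ _)]

lemma robinJ_eq (γ : ℝ) : robinJ γ = ENNReal.ofReal (∫ ξ, robinGap γ ξ) := by
  rw [robinJ, tsum_eq_single 0 fun j hj => robinTerm_of_two_le (by omega) γ,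
    ofReal_integral_eq_lintegral_ofReal (integrable_robinGap γ)
      (Eventually.of_forall (robinGap_nonneg γ))]
  simp only [robinTerm, zero_add, erealNegPart_robinEigenvalue_one]

/-- The integrands are measurable, `𝓙` takes finite values, `𝓙 : ℝ → ℝ` is continuous, and only
finitely many terms of its series are nonzero, locally uniformly in `γ`. -/
theorem lemma3p7 :
    (∀ j : ℕ, 1 ≤ j → ∀ γ : ℝ,
      Measurable (fun ξ : ℝ => erealNegPart (robinEigenvalue j γ ξ - 1))) ∧
    (∀ γ : ℝ, robinJ γ < ⊤) ∧
    Continuous (fun γ : ℝ => (robinJ γ).toReal) ∧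
    (∀ M : ℝ, 0 < M → ∃ j₀ : ℕ, ∀ γ ∈ Ioo (-M) M, ∀ j : ℕ, j₀ < j → robinTerm j γ = 0) := by
  refine ⟨fun j hj γ => ?_, fun γ => ?_, ?_, fun M _ => ⟨1, fun γ _ j hj => ?_⟩⟩
  · rcases hj.eq_or_lt with rfl | hj
    · simp only [erealNegPart_robinEigenvalue_one]
      exact (continuous_robinGap.comp
        (by fun_prop : Continuous fun ξ => (γ, ξ))).measurable.ennreal_ofReal
    · simp only [erealNegPart_of_one_le (one_le_robinEigenvalue hj γ _), measurable_const]
  · rw [robinJ_eq]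
    exact ENNReal.ofReal_lt_top
  · simp only [robinJ_eq, ENNReal.toReal_ofReal (integral_nonneg (robinGap_nonneg _))]
    exact continuous_integral_robinGap
  · exact robinTerm_of_two_le hj γ
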